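/- Let $n\ge 1$ be an integer. Write $L^2=L^2(\mathbb R^n;\mathbb C)$ with norm $\|\cdot\|$, and equip $L^2(\mathbb R^n;\mathbb C^n)$ with the scalar product $(u|v)=\sum_{j=1}^n\int_{\mathbb R^n}u_j\overline{v_j}\,dx$ and its norm, also denoted $\|\cdot\|$. Let $H^1$ be the space of all $\varphi\in L^2$ whose distributional derivatives $\partial_1\varphi,\dots,\partial_n\varphi$ belong to $L^2$, and put $\nabla\varphi=(\partial_1\varphi,\dots,\partial_n\varphi)$ and $x\varphi=(x_1\varphi,\dots,x_n\varphi)$. For $z\in\mathbb C$ let $\operatorname{sgn}z=z/|z|$ if $z\ne0$, and $\operatorname{sgn}0=1$. Let $\varphi\in H^1$ satisfy $x_j\varphi\in L^2$ for all $j$, and put $z=(x\varphi|\nabla\varphi)$. As usual, elements of $L^2$ are identified when they agree almost everywhere, so that pointwise formulas for $\varphi(x)$ are understood for almost every $x\in\mathbb R^n$. **(1)** We have $$n\|\varphi\|^2=-2\operatorname{Re}(x\varphi|\nabla\varphi)=\|x\varphi\|^2+\|\nabla\varphi\|^2-\|x\varphi+\nabla\varphi\|^2 .$$ If moreover $x\varphi\neq0$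 and $\nabla\varphi\ne0$, then $$n\|\varphi\|^2=\|x\varphi\|\,\|\nabla\varphi\|\left(2-\left\|\frac{x\varphi}{\|x\varphi\|}+\frac{\nabla\varphi}{\|\nabla\varphi\|}\right\|^2\right)$$ and $$|(x\varphi|\nabla\varphi)|=\|x\varphi\|\,\|\nabla\varphi\|\left(1-\frac12\left\|\frac{x\varphi}{\|x\varphi\|}-(\operatorname{sgn}z)\frac{\nabla\varphi}{\|\nabla\varphi\|}\right\|^2\right).$$ **(2)** The following are equivalent: (i) $n\|\varphi\|^2=\|x\varphi\|^2+\|\nabla\varphi\|^2$; (ii) $x\varphi=-\nabla\varphi$; (iii) there exists $\theta\in\mathbb R$ such that $$\varphi(x)=e^{i\theta}\,\frac1{\pi^{n/4}}\,\|\varphi\|\exp\left(-\frac{|x|^2}2\right).$$ **(3)** If $x\varphi\ne0$, the following are equivalent: (i) $n\|\varphi\|^2=2\|x\varphi\|\,\|\nabla\varphi\|$; (ii) $\|\nabla\varphi\|\,x\varphi=-\|x\varphi\|\,\nabla\varphi$; (iii) there exists $\theta\in\mathbb R$ such that $$\varphi(x)=e^{i\theta}\left(\frac{\|\nabla\varphi\|}{\pi\|x\varphi\|}\right)^{n/4}\|\varphi\|\exp\left(-\frac{\|\nabla\varphi\|}{\|x\varphi\|}\,\frac{|x|^2}2\right).$$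 **(4)** If $x\varphi\ne0$, the following are equivalent: (i) $|(x\varphi|\nabla\varphi)|=\|x\varphi\|\,\|\nabla\varphi\|$; (ii) $\|\nabla\varphi\|\,x\varphi=(\operatorname{sgn}z)\,\|x\varphi\|\,\nabla\varphi$; (iii) there exists $\theta\in\mathbb R$ such that $$\varphi(x)=e^{i\theta}\left(-(\operatorname{Re}\operatorname{sgn}z)\,\frac{\|\nabla\varphi\|}{\pi\|x\varphi\|}\right)^{n/4}\|\varphi\|\exp\left((\operatorname{sgn}\overline z)\,\frac{\|\nabla\varphi\|}{\|x\varphi\|}\,\frac{|x|^2}2\right).$$ Moreover, if $x\varphi\ne0$ and $\nabla\varphi\neq0$, then $\operatorname{Re}z=\operatorname{Re}\overline z=-\frac n2\|\varphi\|^2<0$ and $\operatorname{Re}\operatorname{sgn}z=\operatorname{Re}\operatorname{sgn}\overline z<0$. -/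

import Mathlib

open MeasureTheory
open scoped ContDiff ComplexConjugate

noncomputable section

/-- The Hilbert space `L²(ℝⁿ; ℂ)`, with respect to Lebesgue measure. -/
abbrev ScalarL2 (n : ℕ) : Type :=
  Lp ℂ 2 (volume : Measure (EuclideanSpace ℝ (Fin n)))

/-- The Hilbert space `L²(ℝⁿ; ℂⁿ)`, realised as the `ℓ²`-sum of `n` copies of `L²(ℝⁿ; ℂ)`:
its scalar product is the sum over `j` of the scalar products of the `j`-th components. -/
abbrev VectorL2 (n : ℕ) : Type :=
  PiLp 2 (fun _ : Fin n => ScalarL2 n)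

/-- The scalar product `(u|v) = ∑ j, ∫ u_j * conj v_j` on `L²(ℝⁿ; ℂⁿ)`, linear in the first and
antilinear in the second variable (Mathlib's `inner` has the opposite convention). -/
def scalarProd {n : ℕ} (u v : VectorL2 n) : ℂ := inner ℂ v u

theorem scalarProd_eq_sum_integral {n : ℕ} (u v : VectorL2 n) :
    scalarProd u v = ∑ j, ∫ x, u j x * conj (v j x) := by
  simp [scalarProd, PiLp.inner_apply, L2.inner_def]

/-- `ψ` is the distributional partial derivative `∂_j φ`, for `φ, ψ ∈ L²(ℝⁿ; ℂ)`:
`∫ (∂_j η) φ = - ∫ η ψ` for all compactly supported smooth functions `η`. -/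
def IsWeakPartialDeriv {n : ℕ} (j : Fin n) (φ ψ : ScalarL2 n) : Prop :=
  ∀ η : EuclideanSpace ℝ (Fin n) → ℝ, ContDiff ℝ ∞ η → HasCompactSupport η →
    ∫ x, (fderiv ℝ η x (EuclideanSpace.single j 1)) • φ x = - ∫ x, η x • ψ x

/-- The distributional partial derivative is unique. -/
theorem IsWeakPartialDeriv.unique {n : ℕ} {j : Fin n} {φ ψ ψ' : ScalarL2 n}
    (h : IsWeakPartialDeriv j φ ψ) (h' : IsWeakPartialDeriv j φ ψ') : ψ = ψ' := by
  apply Lp.ext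
  refine ae_eq_of_integral_contDiff_smul_eq
    ((Lp.memLp ψ).locallyIntegrable (by norm_num))
    ((Lp.memLp ψ').locallyIntegrable (by norm_num)) ?_
  intro η h1 h2
  exact neg_injective ((h η h1 h2).symm.trans (h' η h1 h2))

/-- The Sobolev space `H¹(ℝⁿ)`, i.e. the domain of `A = -i∇`: all `φ ∈ L²` whose distributional
partial derivatives `∂_j φ` belong to `L²`. -/
def momentumDomain (n : ℕ) : Set (ScalarL2 n) :=
  {φ | ∀ j : Fin n, ∃ ψ : ScalarL2 n, IsWeakPartialDeriv j φ ψ}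

/-- The domain of `B = x`: all `φ ∈ L²` such that `x_j φ ∈ L²` for all `j`. -/
def positionDomain (n : ℕ) : Set (ScalarL2 n) :=
  {φ | ∀ j : Fin n, MemLp (fun x => (x j : ℂ) * φ x) 2 volume}

/-- The distributional gradient `∇φ = (∂_1 φ, …, ∂_n φ) ∈ L²(ℝⁿ; ℂⁿ)` of `φ ∈ H¹(ℝⁿ)`. -/
def weakGradient {n : ℕ} (φ : ScalarL2 n) (hφ : φ ∈ momentumDomain n) : VectorL2 n :=
  WithLp.toLp 2 (fun j => (hφ j).choose)

theorem isWeakPartialDeriv_weakGradient {n : ℕ} (φ : ScalarL2 n) (hφ : φ ∈ momentumDomain n)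
    (j : Fin n) : IsWeakPartialDeriv j φ (weakGradient φ hφ j) :=
  (hφ j).choose_spec

/-- The vector `xφ = (x_1 φ, …, x_n φ) ∈ L²(ℝⁿ; ℂⁿ)`, for `φ` in the domain of `B = x`. -/
def positionMul {n : ℕ} (φ : ScalarL2 n) (hφ : φ ∈ positionDomain n) : VectorL2 n :=
  WithLp.toLp 2 (fun j => (hφ j).toLp (fun x => (x j : ℂ) * φ x))

/-- The complex sign `sgn z = z / |z|` for `z ≠ 0`, with the convention `sgn 0 = 1`. -/
def complexSgn (z : ℂ) : ℂ := open Classical in if z = 0 then 1 else z / (‖z‖ : ℂ)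

end

/-!
The theorem combines one analytic identity with elementary Hilbert space geometry.

The identity is `n ‖φ‖² = -2 Re (xφ|∇φ)`, the sum over `j` of the weak commutation relations
`‖φ‖² = -2 Re (x_j φ|∂_j φ)` (`IsWeakPartialDeriv.norm_sq_eq`). No approximation of `φ` by
smooth functions is needed: translations act strongly continuously on `L²`, and a function with a
weak derivative `∂_j φ` in `L²` satisfies `φ(· + t e_j) = φ + ∫ s in 0..t, (∂_j φ)(· + s e_j)`, so
that `t ↦ φ(· + t e_j)` is differentiable at `0` with derivative `∂_j φ`
(`IsWeakPartialDeriv.hasDerivAt_translateL2`). Multiplication by `x_j` is symmetric, and its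
commutator with this translation is `-t` times the translation; differentiating at `t = 0` gives
the claim.

Geometrically, the squared norms of `xφ + ∇φ`, of `‖∇φ‖ xφ + ‖xφ‖ ∇φ` and of
`‖∇φ‖ xφ - sgn(z) ‖xφ‖ ∇φ` are explicit multiples of the defects in the inequalities
`n ‖φ‖² ≤ ‖xφ‖² + ‖∇φ‖²`, `n ‖φ‖² ≤ 2 ‖xφ‖ ‖∇φ‖` and `|z| ≤ ‖xφ‖ ‖∇φ‖`. Hence
equality holds exactly when `∇φ = w xφ`, with `w = -1`, `w = -‖∇φ‖/‖xφ‖` or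
`w = sgn(conj z) ‖∇φ‖/‖xφ‖` respectively, and `Re w < 0` in each case.

For such `w` the equation `∇φ = w xφ` forces `exp (-w|x|²/2) φ` to have vanishing distributional
gradient, and a locally integrable function with this property is constant, as one sees by
mollification (`exists_ae_eq_const_of_integral_fderiv_smul_eq_zero`). The Gaussian integral fixes
the modulus of the constant (`weakGradient_eq_smul_positionMul_iff`).
-/

open Filter Topology

/-! ### Mollification and functions with vanishing gradient -/

section Convolution

variable {n : ℕ}

/-- Differentiation under the integral sign for the correlation `y ↦ ∫ η (x - y) • f x` of a
locally integrable function with a test function. -/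
theorem hasFDerivAt_integral_comp_sub_smul {f : EuclideanSpace ℝ (Fin n) → ℂ}
    (hf : LocallyIntegrable f) {η : EuclideanSpace ℝ (Fin n) → ℝ} (hη : ContDiff ℝ ∞ η)
    (hc : HasCompactSupport η) (y : EuclideanSpace ℝ (Fin n)) :
    ∃ D : EuclideanSpace ℝ (Fin n) →L[ℝ] ℂ,
      HasFDerivAt (fun y => ∫ x, η (x - y) • f x) D y ∧
        ∀ v, D v = -∫ x, (fderiv ℝ η (x - y) v) • f x := by
  set L : ℂ →L[ℝ] ℝ →L[ℝ] ℂ := (ContinuousLinearMap.lsmul ℝ ℝ).flip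
  set ζ : EuclideanSpace ℝ (Fin n) → ℝ := fun u => η (-u)
  have hζ : ContDiff ℝ ∞ ζ := hη.comp contDiff_neg
  have hζ1 : ContDiff ℝ 1 ζ := hζ.of_le (by simp)
  have hζc : HasCompactSupport ζ := hc.comp_homeomorph (Homeomorph.neg _)
  have key := hζc.hasFDerivAt_convolution_right L (μ := volume) hf hζ1 y
  have e1 : (convolution f ζ L volume) = fun y => ∫ x, η (x - y) • f x := by
    ext y
    simp [convolution_def, L, ζ]
  rw [e1] at key
  refine ⟨_, key, fun v => ?_⟩
  rw [convolution_precompR_apply L hf (hζc.fderiv ℝ) (hζ1.continuous_fderiv one_ne_zero),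
    convolution_def, ← integral_neg]
  congr 1 with x
  have : fderiv ℝ ζ (y - x) v = -fderiv ℝ η (x - y) v := by
    have h1 := ((hη.differentiable (by simp)) (-(y - x))).hasFDerivAt.comp (y - x)
      (hasFDerivAt_id (𝕜 := ℝ) (y - x)).neg
    rw [show ζ = η ∘ Neg.neg from rfl, h1.fderiv]
    simp
  simp [L, this]

/-- A locally integrable function on `ℝⁿ` whose distributional partial derivatives all vanish is
constant: its mollifications have zero derivative, hence are constant, and they converge to it
almost everywhere. -/
theorem exists_ae_eq_const_of_integral_fderiv_smul_eq_zero {f : EuclideanSpace ℝ (Fin n) → ℂ}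
    (hf : LocallyIntegrable f)
    (h : ∀ (j : Fin n) (η : EuclideanSpace ℝ (Fin n) → ℝ), ContDiff ℝ ∞ η →
      HasCompactSupport η → ∫ x, (fderiv ℝ η x (EuclideanSpace.single j 1)) • f x = 0) :
    ∃ c : ℂ, ∀ᵐ x, f x = c := by
  -- The ratio of the radii stays bounded, as almost everywhere convergence requires.
  let ρ : ℕ → ContDiffBump (0 : EuclideanSpace ℝ (Fin n)) := fun k =>
    ⟨1 / ((k : ℝ) + 1), 2 * (1 / ((k : ℝ) + 1)), by positivity,
      by have : 0 < 1 / ((k : ℝ) + 1) := by positivity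
         linarith⟩
  have hρ : Tendsto (fun k => (ρ k).rOut) atTop (𝓝 0) := by
    simpa [ρ] using (tendsto_one_div_add_atTop_nhds_zero_nat (𝕜 := ℝ)).const_mul 2
  have hae := ContDiffBump.ae_convolution_tendsto_right_of_locallyIntegrable (μ := volume)
    (φ := ρ) (l := atTop) (K := 2) hρ (Eventually.of_forall fun k => le_rfl) hf
  have hconst : ∀ (k : ℕ) (y : EuclideanSpace ℝ (Fin n)),
      convolution ((ρ k).normed volume) f (ContinuousLinearMap.lsmul ℝ ℝ) volume y
        = ∫ x, (ρ k).normed volume x • f x := by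
    intro k y
    set η := (ρ k).normed volume
    have hη : ContDiff ℝ ∞ η := (ρ k).contDiff_normed
    have hc : HasCompactSupport η := (ρ k).hasCompactSupport_normed
    have e1 : ∀ y, convolution η f (ContinuousLinearMap.lsmul ℝ ℝ) volume y
        = ∫ x, η (x - y) • f x := by
      intro y
      rw [convolution_eq_swap]
      congr 1 with x
      have : η (y - x) = η (x - y) := by
        rw [← neg_sub]; exact (ρ k).normed_neg _
      simp [this]
    choose D hD hDv using hasFDerivAt_integral_comp_sub_smul hf hη hc
    have hD0 : ∀ y, D y = 0 := by
      intro y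
      have hsub : ContDiff ℝ ∞ fun x => η (x - y) := hη.comp (contDiff_id.sub contDiff_const)
      have hsubc : HasCompactSupport fun x => η (x - y) :=
        hc.comp_homeomorph (Homeomorph.subRight y)
      refine ContinuousLinearMap.coe_injective
        ((EuclideanSpace.basisFun (Fin n) ℝ).toBasis.ext fun j => ?_)
      have := h j _ hsub hsubc
      simp only [fderiv_comp_sub] at this
      simpa [hDv] using this
    have := is_const_of_fderiv_eq_zero (𝕜 := ℝ) (fun y => (hD y).differentiableAt)
      (fun y => (hD y).fderiv.trans (hD0 y)) y 0
    simpa [e1] using this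
  obtain ⟨x₀, hx₀⟩ := hae.exists
  refine ⟨f x₀, hae.mono fun x hx => ?_⟩
  simp only [hconst] at hx hx₀
  exact tendsto_nhds_unique hx hx₀

end Convolution

/-! ### Translations on `L²` and the commutation relation -/

section Translation

variable {n : ℕ}

/-- Translation by `a` on `L²(ℝⁿ; ℂ)`, i.e. `(translateL2 a f) x = f (x + a)`, as a linear
isometry. -/
noncomputable def translateL2 (a : EuclideanSpace ℝ (Fin n)) : ScalarL2 n →ₗᵢ[ℂ] ScalarL2 n :=
  Lp.compMeasurePreservingₗᵢ ℂ (fun x => x + a) (measurePreserving_add_right volume a)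

theorem coeFn_translateL2 (a : EuclideanSpace ℝ (Fin n)) (f : ScalarL2 n) :
    translateL2 a f =ᵐ[volume] fun x => f (x + a) :=
  Lp.coeFn_compMeasurePreserving f (measurePreserving_add_right volume a)

theorem translateL2_zero (f : ScalarL2 n) : translateL2 0 f = f := by
  apply Lp.ext
  filter_upwards [coeFn_translateL2 0 f] with x hx
  simpa using hx

theorem translateL2_translateL2 (a b : EuclideanSpace ℝ (Fin n)) (f : ScalarL2 n) :
    translateL2 a (translateL2 b f) = translateL2 (a + b) f := by
  apply Lp.ext
  filter_upwards [coeFn_translateL2 a (translateL2 b f), coeFn_translateL2 (a + b) f,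
    (measurePreserving_add_right volume a).quasiMeasurePreserving.ae (coeFn_translateL2 b f)]
    with x h1 h2 h3
  rw [h1, h2, h3, add_assoc]

theorem continuous_translateL2 (f : ScalarL2 n) :
    Continuous fun a : EuclideanSpace ℝ (Fin n) => translateL2 a f := by
  have hg : Continuous fun a : EuclideanSpace ℝ (Fin n) =>
      (⟨fun x => x + a, by fun_prop⟩ : C(EuclideanSpace ℝ (Fin n), EuclideanSpace ℝ (Fin n))) :=
    ContinuousMap.continuous_of_continuous_uncurry _ (by
      simp only [Function.uncurry_def, ContinuousMap.coe_mk]; fun_prop)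
  exact Continuous.compMeasurePreservingLp (f := fun _ => f) continuous_const hg
    (fun a => measurePreserving_add_right volume a) (by norm_num)

/-- A real test function, as an element of `L²(ℝⁿ; ℂ)`. -/
noncomputable def testL2 {η : EuclideanSpace ℝ (Fin n) → ℝ} (hη : ContDiff ℝ ∞ η)
    (hc : HasCompactSupport η) : ScalarL2 n :=
  ((Complex.continuous_ofReal.comp hη.continuous).memLp_of_hasCompactSupport
    (p := 2) (μ := volume) (hc.comp_left Complex.ofReal_zero)).toLp _

theorem inner_testL2 {η : EuclideanSpace ℝ (Fin n) → ℝ} (hη : ContDiff ℝ ∞ η)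
    (hc : HasCompactSupport η) (f : ScalarL2 n) :
    inner ℂ (testL2 hη hc) f = ∫ x, η x • f x := by
  rw [L2.inner_def]
  refine integral_congr_ae ?_
  filter_upwards [MemLp.coeFn_toLp ((Complex.continuous_ofReal.comp
    hη.continuous).memLp_of_hasCompactSupport (p := 2) (μ := volume)
      (hc.comp_left Complex.ofReal_zero))] with x hx
  simp only [testL2]
  rw [hx]
  simp [mul_comm]

/-- Elements of `L²` are determined by their pairings with test functions. -/
theorem ext_inner_testL2 {f g : ScalarL2 n}
    (h : ∀ (η : EuclideanSpace ℝ (Fin n) → ℝ) (hη : ContDiff ℝ ∞ η) (hc : HasCompactSupport η),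
      inner ℂ (testL2 hη hc) f = inner ℂ (testL2 hη hc) g) : f = g := by
  apply Lp.ext
  refine ae_eq_of_integral_contDiff_smul_eq
    ((Lp.memLp f).locallyIntegrable (by norm_num))
    ((Lp.memLp g).locallyIntegrable (by norm_num)) fun η hη hc => ?_
  simpa only [inner_testL2] using h η hη hc

theorem inner_testL2_translateL2 {η : EuclideanSpace ℝ (Fin n) → ℝ} (hη : ContDiff ℝ ∞ η)
    (hc : HasCompactSupport η) (a : EuclideanSpace ℝ (Fin n)) (f : ScalarL2 n) :
    inner ℂ (testL2 hη hc) (translateL2 a f) = ∫ x, η (x - a) • f x := by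
  rw [inner_testL2, ← integral_add_right_eq_self (fun x => η (x - a) • f x) a]
  refine integral_congr_ae ?_
  filter_upwards [coeFn_translateL2 a f] with x hx
  simp [hx]

/-- Translates of `φ`, tested against a smooth function, are differentiable in the direction `e_j`
and the derivative is obtained by translating the weak derivative. -/
theorem IsWeakPartialDeriv.hasDerivAt_inner_translateL2 {j : Fin n} {φ ψ : ScalarL2 n}
    (h : IsWeakPartialDeriv j φ ψ) {η : EuclideanSpace ℝ (Fin n) → ℝ} (hη : ContDiff ℝ ∞ η)
    (hc : HasCompactSupport η) (t : ℝ) :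
    HasDerivAt
      (fun t : ℝ => inner ℂ (testL2 hη hc) (translateL2 (t • EuclideanSpace.single j 1) φ))
      (inner ℂ (testL2 hη hc) (translateL2 (t • EuclideanSpace.single j 1) ψ)) t := by
  simp only [inner_testL2_translateL2]
  set a : EuclideanSpace ℝ (Fin n) := t • EuclideanSpace.single j 1 with ha
  obtain ⟨D, hD, hDv⟩ := hasFDerivAt_integral_comp_sub_smul
    ((Lp.memLp φ).locallyIntegrable (by norm_num)) hη hc a
  have hline : HasDerivAt (fun t : ℝ => t • (EuclideanSpace.single j 1 : EuclideanSpace ℝ (Fin n)))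
      (EuclideanSpace.single j 1) t := by
    simpa using (hasDerivAt_id t).smul_const (EuclideanSpace.single j (1 : ℝ))
  have key := hD.comp_hasDerivAt t hline
  have hsub : ContDiff ℝ ∞ fun x => η (x - a) := hη.comp (contDiff_id.sub contDiff_const)
  have hsubc : HasCompactSupport fun x => η (x - a) := hc.comp_homeomorph (Homeomorph.subRight a)
  have hw := h _ hsub hsubc
  simp only [fderiv_comp_sub] at hw
  rw [hDv, hw, neg_neg] at key
  exact key

/-- The translation group on `L²` is strongly differentiable at functions with a weak derivative in
`L²`: indeed `translateL2 (t e_j) φ = φ + ∫ s in 0..t, translateL2 (s e_j) ψ`, because both sides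
have the same pairings with test functions. -/
theorem IsWeakPartialDeriv.hasDerivAt_translateL2 {j : Fin n} {φ ψ : ScalarL2 n}
    (h : IsWeakPartialDeriv j φ ψ) :
    HasDerivAt (fun t : ℝ => translateL2 (t • EuclideanSpace.single j 1) φ) ψ 0 := by
  have hcont : Continuous fun t : ℝ =>
      translateL2 (t • (EuclideanSpace.single j 1 : EuclideanSpace ℝ (Fin n))) ψ :=
    (continuous_translateL2 ψ).comp (by fun_prop)
  have heq : (fun t : ℝ => translateL2 (t • EuclideanSpace.single j 1) φ) = fun t =>
      φ + ∫ s in (0 : ℝ)..t, translateL2 (s • EuclideanSpace.single j 1) ψ := by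
    ext1 t
    refine ext_inner_testL2 fun η hη hc => ?_
    have h1 := intervalIntegral.integral_eq_sub_of_hasDerivAt (a := 0) (b := t)
      (fun s _ => h.hasDerivAt_inner_translateL2 hη hc s)
      ((continuous_const.inner hcont).intervalIntegrable _ _)
    have h2 := (innerSL ℂ (testL2 hη hc)).intervalIntegral_comp_comm
      (hcont.intervalIntegrable (μ := volume) 0 t)
    simp only [innerSL_apply_apply] at h2
    rw [inner_add_right, ← h2, h1, zero_smul, translateL2_zero]
    ring
  rw [heq]
  have := intervalIntegral.integral_hasDerivAt_right (hcont.intervalIntegrable (μ := volume) 0 0)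
    hcont.aestronglyMeasurable.stronglyMeasurableAtFilter hcont.continuousAt
  simpa [translateL2_zero] using this.const_add φ

/-- The canonical commutation relation `[∂_j, x_j] = 1` in weak form. It is obtained by
differentiating at `t = 0` the identity
`(φ, x_j φ(· + t e_j)) = (φ(· - t e_j), x_j φ) - t (φ, φ(· + t e_j))`, in which the left-hand
side is `(x_j φ, φ(· + t e_j))`. -/
theorem IsWeakPartialDeriv.norm_sq_eq {j : Fin n} {φ ψ ξ : ScalarL2 n}
    (h : IsWeakPartialDeriv j φ ψ) (hξ : ∀ᵐ x, ξ x = (x j : ℂ) * φ x) :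
    ‖φ‖ ^ 2 = -2 * (inner ℂ ψ ξ).re := by
  set e : EuclideanSpace ℝ (Fin n) := EuclideanSpace.single j 1 with he
  have hid : ∀ t : ℝ, inner ℂ (translateL2 ((-t) • e) φ) ξ - t * inner ℂ φ (translateL2 (t • e) φ)
      = inner ℂ ξ (translateL2 (t • e) φ) := by
    intro t
    have h1 : inner ℂ (translateL2 ((-t) • e) φ) ξ = inner ℂ φ (translateL2 (t • e) ξ) := by
      rw [← (translateL2 (t • e)).inner_map_map, translateL2_translateL2]
      simp [translateL2_zero]
    have h2 : (t : ℂ) * inner ℂ φ (translateL2 (t • e) φ)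
        = inner ℂ φ ((t : ℂ) • translateL2 (t • e) φ) := by rw [inner_smul_right]
    rw [h1, h2, ← inner_sub_right, L2.inner_def, L2.inner_def]
    refine integral_congr_ae ?_
    filter_upwards [hξ, Lp.coeFn_sub (translateL2 (t • e) ξ) ((t : ℂ) • translateL2 (t • e) φ),
      Lp.coeFn_smul (t : ℂ) (translateL2 (t • e) φ), coeFn_translateL2 (t • e) φ,
      coeFn_translateL2 (t • e) ξ,
      (measurePreserving_add_right volume (t • e)).quasiMeasurePreserving.ae hξ]
      with x h1 h2 h3 h4 h5 h6
    rw [h2, Pi.sub_apply, h3, Pi.smul_apply, h4, h5, h6, h1]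
    simp [he]
    ring
  have hT := h.hasDerivAt_translateL2
  have hTneg : HasDerivAt (fun t : ℝ => translateL2 ((-t) • e) φ) (-ψ) 0 := by
    have := HasDerivAt.scomp (h := fun t : ℝ => -t) (0 : ℝ) (by simpa using hT) (hasDerivAt_neg 0)
    simpa [Function.comp_def] using this
  have hre := HasDerivAt.inner ℂ (hasDerivAt_const (0 : ℝ) ξ) hT
  have hl1 := HasDerivAt.inner ℂ hTneg (hasDerivAt_const (0 : ℝ) ξ)
  have hl2 := (Complex.ofRealCLM.hasDerivAt (x := (0 : ℝ))).mul
    (HasDerivAt.inner ℂ (hasDerivAt_const (0 : ℝ) φ) hT)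
  have := (hl1.sub hl2).unique (hre.congr_of_eventuallyEq (Eventually.of_forall fun t => hid t))
  have := congrArg Complex.re this
  have hs : (inner ℂ ξ ψ : ℂ).re = (inner ℂ ψ ξ : ℂ).re := inner_re_symm (𝕜 := ℂ) _ _
  simp [translateL2_zero, hs, ← Complex.ofReal_pow] at this
  linarith

end Translation

/-! ### The equation `∂_j φ = w x_j φ` -/

section GradientEquation

variable {n : ℕ}

theorem fderiv_clm_comp_apply {E F G : Type*} [NormedAddCommGroup E] [NormedSpace ℝ E]
    [NormedAddCommGroup F] [NormedSpace ℝ F] [NormedAddCommGroup G] [NormedSpace ℝ G]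
    (ℓ : F →L[ℝ] G) {f : E → F} {x : E} (hf : DifferentiableAt ℝ f x) (v : E) :
    fderiv ℝ (fun y => ℓ (f y)) x v = ℓ (fderiv ℝ f x v) := by
  have := (ℓ.hasFDerivAt.comp x hf.hasFDerivAt).fderiv
  rw [show (fun y => ℓ (f y)) = ℓ ∘ f from rfl, this]
  rfl

/-- The defining identity of the weak derivative extends to complex-valued test functions. -/
theorem IsWeakPartialDeriv.integral_fderiv_mul {j : Fin n} {φ ψ : ScalarL2 n}
    (h : IsWeakPartialDeriv j φ ψ) {ζ : EuclideanSpace ℝ (Fin n) → ℂ} (hζ : ContDiff ℝ ∞ ζ)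
    (hc : HasCompactSupport ζ) :
    ∫ x, (fderiv ℝ ζ x (EuclideanSpace.single j 1)) * φ x = -∫ x, ζ x * ψ x := by
  have hφ : LocallyIntegrable φ := (Lp.memLp φ).locallyIntegrable (by norm_num)
  have hψ : LocallyIntegrable ψ := (Lp.memLp ψ).locallyIntegrable (by norm_num)
  -- Pairings with the composition of `ζ` with a real-linear functional `ℓ`, here `re` or `im`.
  have key : ∀ ℓ : ℂ →L[ℝ] ℝ,
      Integrable (fun x => ℓ (fderiv ℝ ζ x (EuclideanSpace.single j 1)) • φ x) ∧
      Integrable (fun x => ℓ (ζ x) • ψ x) ∧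
      ∫ x, ℓ (fderiv ℝ ζ x (EuclideanSpace.single j 1)) • φ x = -∫ x, ℓ (ζ x) • ψ x := by
    intro ℓ
    have h1 : ContDiff ℝ ∞ (fun x => ℓ (ζ x)) := ℓ.contDiff.comp hζ
    have h2 : HasCompactSupport (fun x => ℓ (ζ x)) := hc.comp_left (map_zero ℓ)
    have h3 : ∀ x, fderiv ℝ (fun x => ℓ (ζ x)) x (EuclideanSpace.single j 1)
        = ℓ (fderiv ℝ ζ x (EuclideanSpace.single j 1)) := fun x =>
      fderiv_clm_comp_apply ℓ ((hζ.differentiable (by simp)) x) _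
    have h4 : Continuous fun x => ℓ (fderiv ℝ ζ x (EuclideanSpace.single j 1)) :=
      ℓ.continuous.comp ((hζ.continuous_fderiv (by simp)).clm_apply continuous_const)
    have h5 : HasCompactSupport fun x => ℓ (fderiv ℝ ζ x (EuclideanSpace.single j 1)) :=
      (hc.fderiv_apply ℝ _).comp_left (map_zero ℓ)
    refine ⟨hφ.integrable_smul_left_of_hasCompactSupport h4 h5,
      hψ.integrable_smul_left_of_hasCompactSupport h1.continuous h2, ?_⟩
    have := h _ h1 h2
    simp only [h3] at this
    exact this
  obtain ⟨r1, r2, r3⟩ := key Complex.reCLM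
  obtain ⟨i1, i2, i3⟩ := key Complex.imCLM
  have split : ∀ z w : ℂ, z * w = Complex.reCLM z • w + Complex.I * (Complex.imCLM z • w) := by
    intro z w
    conv_lhs => rw [← Complex.re_add_im z]
    simp only [Complex.reCLM_apply, Complex.imCLM_apply, Complex.real_smul]
    ring
  simp only [fun x => split (fderiv ℝ ζ x (EuclideanSpace.single j 1)) (φ x),
    fun x => split (ζ x) (ψ x)]
  rw [integral_add r1 (i1.const_mul _), integral_add r2 (i2.const_mul _), integral_const_mul,
    integral_const_mul, r3, i3]
  ring

theorem contDiff_cexp_mul_norm_sq (w : ℂ) :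
    ContDiff ℝ ∞ fun x : EuclideanSpace ℝ (Fin n) => Complex.exp (w * ((‖x‖ : ℂ) ^ 2 / 2)) := by
  have h : ContDiff ℝ ∞ fun x : EuclideanSpace ℝ (Fin n) => ((‖x‖ ^ 2 : ℝ) : ℂ) :=
    Complex.ofRealCLM.contDiff.comp (contDiff_norm_sq ℝ)
  simp only [Complex.ofReal_pow] at h
  exact (contDiff_const.mul (h.div_const 2)).cexp

theorem fderiv_cexp_mul_norm_sq (w : ℂ) (x : EuclideanSpace ℝ (Fin n)) (j : Fin n) :
    fderiv ℝ (fun x : EuclideanSpace ℝ (Fin n) => Complex.exp (w * ((‖x‖ : ℂ) ^ 2 / 2))) x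
      (EuclideanSpace.single j 1) = w * x j * Complex.exp (w * ((‖x‖ : ℂ) ^ 2 / 2)) := by
  have h0 : HasFDerivAt (fun x : EuclideanSpace ℝ (Fin n) => ((‖x‖ ^ 2 : ℝ) : ℂ)) _ x :=
    Complex.ofRealCLM.hasFDerivAt.comp x (hasStrictFDerivAt_norm_sq x).hasFDerivAt
  simp only [Complex.ofReal_pow] at h0
  have h1 := ((h0.mul_const (2⁻¹ : ℂ)).const_mul w).cexp
  simp only [← div_eq_mul_inv] at h1
  rw [h1.fderiv]
  simp [EuclideanSpace.inner_single_right]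
  ring

/-- An `L²` solution of `∂_j φ = w x_j φ`, `j = 1, …, n`, is a multiple of `exp (w |x|² / 2)`:
the distributional gradient of `exp (-w |x|² / 2) φ` vanishes. -/
theorem exists_ae_eq_mul_cexp {φ : ScalarL2 n} {ψ : Fin n → ScalarL2 n} (w : ℂ)
    (h : ∀ j, IsWeakPartialDeriv j φ (ψ j)) (hψ : ∀ j, ∀ᵐ x, ψ j x = w * (x j * φ x)) :
    ∃ c : ℂ, ∀ᵐ x, φ x = c * Complex.exp (w * ((‖x‖ : ℂ) ^ 2 / 2)) := by
  set E : EuclideanSpace ℝ (Fin n) → ℂ := fun x => Complex.exp (-w * ((‖x‖ : ℂ) ^ 2 / 2)) with hE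
  have hEs : ContDiff ℝ ∞ E := contDiff_cexp_mul_norm_sq (-w)
  have hloc : LocallyIntegrable (fun x => E x * φ x) := by
    rw [locallyIntegrable_iff]
    intro K hK
    exact (((Lp.memLp φ).locallyIntegrable (by norm_num)).integrableOn_isCompact
      hK).continuousOn_mul hEs.continuous.continuousOn hK
  obtain ⟨c, hcst⟩ := exists_ae_eq_const_of_integral_fderiv_smul_eq_zero hloc fun j η hη hc => by
    have hη' : ContDiff ℝ ∞ fun x => (η x : ℂ) := Complex.ofRealCLM.contDiff.comp hη
    have hζ : ContDiff ℝ ∞ fun x => (η x : ℂ) * E x := hη'.mul hEs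
    have hζc : HasCompactSupport fun x => (η x : ℂ) * E x :=
      (hc.comp_left Complex.ofReal_zero : HasCompactSupport fun x => (η x : ℂ)).mul_right
    have key := (h j).integral_fderiv_mul hζ hζc
    have hη1 : ∀ x, fderiv ℝ (fun x => (η x : ℂ)) x (EuclideanSpace.single j 1)
        = (fderiv ℝ η x (EuclideanSpace.single j 1) : ℂ) := fun x =>
      fderiv_clm_comp_apply Complex.ofRealCLM ((hη.differentiable (by simp)) x) _
    have hd : ∀ x, fderiv ℝ (fun x => (η x : ℂ) * E x) x (EuclideanSpace.single j 1)
        = (fderiv ℝ η x (EuclideanSpace.single j 1) : ℂ) * E x - η x * E x * (w * x j) := by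
      intro x
      rw [fderiv_fun_mul ((hη'.differentiable (by simp)) x) ((hEs.differentiable (by simp)) x)]
      simp only [add_apply, smul_apply, hη1, smul_eq_mul]
      rw [hE, fderiv_cexp_mul_norm_sq]
      ring
    have hφ : LocallyIntegrable φ := (Lp.memLp φ).locallyIntegrable (by norm_num)
    have i1 : Integrable fun x => fderiv ℝ (fun x => (η x : ℂ) * E x) x
        (EuclideanSpace.single j 1) * φ x :=
      hφ.integrable_smul_left_of_hasCompactSupport
        ((hζ.continuous_fderiv (by simp)).clm_apply continuous_const) (hζc.fderiv_apply ℝ _)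
    have i2 : Integrable fun x => (η x : ℂ) * E x * ψ j x :=
      ((Lp.memLp (ψ j)).locallyIntegrable
        (by norm_num)).integrable_smul_left_of_hasCompactSupport hζ.continuous hζc
    rw [eq_neg_iff_add_eq_zero, ← integral_add i1 i2] at key
    rw [← key]
    refine integral_congr_ae ?_
    filter_upwards [hψ j] with x hx
    rw [hd, hx, Complex.real_smul]
    ring
  refine ⟨c, hcst.mono fun x hx => ?_⟩
  rw [← hx, hE, mul_right_comm, ← Complex.exp_add]
  simp

/-- A Gaussian in `L²` satisfies `∂_j φ = w x_j φ`, by the classical integration by parts. -/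
theorem isWeakPartialDeriv_of_ae_eq_mul_cexp {φ ψ : ScalarL2 n} {w c : ℂ} {j : Fin n}
    (hφ : ∀ᵐ x, φ x = c * Complex.exp (w * ((‖x‖ : ℂ) ^ 2 / 2)))
    (hψ : ∀ᵐ x, ψ x = w * (x j * φ x)) : IsWeakPartialDeriv j φ ψ := by
  intro η hη hc
  set E : EuclideanSpace ℝ (Fin n) → ℂ := fun x => Complex.exp (w * ((‖x‖ : ℂ) ^ 2 / 2)) with hE
  have hEs : ContDiff ℝ ∞ E := contDiff_cexp_mul_norm_sq w
  have hη' : ContDiff ℝ ∞ fun x => (η x : ℂ) := Complex.ofRealCLM.contDiff.comp hη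
  have hc' : HasCompactSupport fun x => (η x : ℂ) := hc.comp_left Complex.ofReal_zero
  have hη1 : ∀ x, fderiv ℝ (fun x => (η x : ℂ)) x (EuclideanSpace.single j 1)
      = (fderiv ℝ η x (EuclideanSpace.single j 1) : ℂ) := fun x =>
    fderiv_clm_comp_apply Complex.ofRealCLM ((hη.differentiable (by simp)) x) _
  have c1 : Continuous fun x => fderiv ℝ (fun x => (η x : ℂ)) x (EuclideanSpace.single j 1) :=
    (hη'.continuous_fderiv (by simp)).clm_apply continuous_const
  have c2 : Continuous fun x => fderiv ℝ E x (EuclideanSpace.single j 1) :=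
    (hEs.continuous_fderiv (by simp)).clm_apply continuous_const
  have key := integral_mul_fderiv_eq_neg_fderiv_mul_of_integrable (μ := volume)
    (f := fun x => (η x : ℂ)) (g := E) (v := EuclideanSpace.single j 1)
    ((c1.mul hEs.continuous).integrable_of_hasCompactSupport (hc'.fderiv_apply ℝ _).mul_right)
    ((hη'.continuous.mul c2).integrable_of_hasCompactSupport hc'.mul_right)
    ((hη'.continuous.mul hEs.continuous).integrable_of_hasCompactSupport hc'.mul_right)
    (fun x _ => (hη'.differentiable (by simp)) x) (fun x _ => (hEs.differentiable (by simp)) x)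
  have e1 : ∫ x, (fderiv ℝ η x (EuclideanSpace.single j 1)) • φ x = c * ∫ x,
      fderiv ℝ (fun x => (η x : ℂ)) x (EuclideanSpace.single j 1) * E x := by
    rw [← integral_const_mul]
    refine integral_congr_ae ?_
    filter_upwards [hφ] with x hx
    rw [hη1, hx, Complex.real_smul]
    ring
  have e2 : ∫ x, η x • ψ x = c * ∫ x, (η x : ℂ) * fderiv ℝ E x (EuclideanSpace.single j 1) := by
    rw [← integral_const_mul]
    refine integral_congr_ae ?_
    filter_upwards [hφ, hψ] with x hx hx'
    rw [hx', hx, hE, fderiv_cexp_mul_norm_sq, Complex.real_smul]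
    ring
  rw [e1, e2, key]
  ring

theorem norm_sq_of_ae_eq_mul_cexp {φ : ScalarL2 n} {w c : ℂ} (hw : w.re < 0)
    (hφ : ∀ᵐ x, φ x = c * Complex.exp (w * ((‖x‖ : ℂ) ^ 2 / 2))) :
    ‖φ‖ ^ 2 = ‖c‖ ^ 2 * (Real.pi / -w.re) ^ ((n : ℝ) / 2) := by
  have h1 : ‖φ‖ ^ 2 = ∫ x, ‖φ x‖ ^ 2 := by
    have h2 : (inner ℂ φ φ : ℂ) = ∫ x, ((‖φ x‖ ^ 2 : ℝ) : ℂ) := by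
      rw [L2.inner_def]
      refine integral_congr_ae (Eventually.of_forall fun x => ?_)
      simp only [inner_self_eq_norm_sq_to_K]
      norm_cast
    rw [inner_self_eq_norm_sq_to_K, integral_complex_ofReal] at h2
    exact Complex.ofReal_injective ((Complex.ofReal_pow _ _).trans h2)
  have h3 : ∫ x, ‖φ x‖ ^ 2 = ∫ x : EuclideanSpace ℝ (Fin n),
      ‖c‖ ^ 2 * Real.exp (-(-w.re) * ‖x‖ ^ 2) := by
    refine integral_congr_ae (hφ.mono fun x hx => ?_)
    simp only [hx, norm_mul, Complex.norm_exp, mul_pow, ← Real.exp_nat_mul]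
    congr 2
    have : ((‖x‖ : ℂ) ^ 2 / 2) = ((‖x‖ ^ 2 / 2 : ℝ) : ℂ) := by push_cast; rfl
    rw [this, Complex.re_mul_ofReal]
    push_cast
    ring
  rw [h1, h3, integral_const_mul, GaussianFourier.integral_rexp_neg_mul_sq_norm (by linarith)]
  simp

end GradientEquation

/-! ### The complex sign and parallel vectors in a Hilbert space -/

section ComplexSgn

theorem norm_complexSgn (z : ℂ) : ‖complexSgn z‖ = 1 := by
  unfold complexSgn
  split_ifs with h
  · simp
  · simp [norm_ne_zero_iff.mpr h]

theorem complexSgn_mul_conj (z : ℂ) : complexSgn z * conj z = (‖z‖ : ℂ) := by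
  unfold complexSgn
  split_ifs with h
  · simp [h]
  · have : (‖z‖ : ℂ) ≠ 0 := by simpa using h
    rw [div_mul_eq_mul_div, Complex.mul_conj, Complex.normSq_eq_norm_sq]
    push_cast
    field_simp

theorem complexSgn_conj (z : ℂ) : complexSgn (conj z) = conj (complexSgn z) := by
  unfold complexSgn
  by_cases h : z = 0 <;> simp [h]

theorem complexSgn_mul_complexSgn_conj (z : ℂ) : complexSgn z * complexSgn (conj z) = 1 := by
  rw [complexSgn_conj, Complex.mul_conj, Complex.normSq_eq_norm_sq, norm_complexSgn]
  simp

theorem complexSgn_re_neg {z : ℂ} (h : z.re < 0) : (complexSgn z).re < 0 := by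
  have h0 : z ≠ 0 := by rintro rfl; simp at h
  rw [complexSgn, if_neg h0, Complex.div_ofReal_re]
  exact div_neg_of_neg_of_pos h (norm_pos_iff.mpr h0)

end ComplexSgn

section ParallelVectors

variable {E : Type*} [NormedAddCommGroup E] [InnerProductSpace ℂ E]

theorem norm_smul_add_smul_sq (u v : E) (p q : ℝ) :
    ‖(p : ℂ) • u + (q : ℂ) • v‖ ^ 2
      = p ^ 2 * ‖u‖ ^ 2 + q ^ 2 * ‖v‖ ^ 2 + 2 * p * q * (inner ℂ v u : ℂ).re := by
  have hs : (inner ℂ u v : ℂ).re = (inner ℂ v u : ℂ).re := inner_re_symm (𝕜 := ℂ) _ _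
  have hpq : (inner ℂ ((p : ℂ) • u) ((q : ℂ) • v) : ℂ) = ((p * q : ℝ) : ℂ) * inner ℂ u v := by
    simp only [inner_smul_left, inner_smul_right, Complex.conj_ofReal]
    push_cast
    ring
  rw [norm_add_sq (𝕜 := ℂ), hpq, RCLike.re_to_complex, Complex.re_ofReal_mul, hs]
  simp only [norm_smul, Complex.norm_real, mul_pow, Real.norm_eq_abs, sq_abs]
  ring

/-- The phase of `(u|v)` makes `v` maximally aligned with `u`. -/
theorem norm_smul_sub_complexSgn_smul_sq (u v : E) (p q : ℝ) :
    ‖(p : ℂ) • u - complexSgn (inner ℂ v u) • (q : ℂ) • v‖ ^ 2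
      = p ^ 2 * ‖u‖ ^ 2 + q ^ 2 * ‖v‖ ^ 2 - 2 * p * q * ‖(inner ℂ v u : ℂ)‖ := by
  have hs : (inner ℂ ((p : ℂ) • u) (complexSgn (inner ℂ v u) • (q : ℂ) • v) : ℂ)
      = ((p * q * ‖(inner ℂ v u : ℂ)‖ : ℝ) : ℂ) := by
    simp only [inner_smul_left, inner_smul_right, Complex.conj_ofReal]
    push_cast
    rw [← complexSgn_mul_conj, inner_conj_symm]
    ring
  rw [norm_sub_sq (𝕜 := ℂ), hs]
  simp [norm_smul, norm_complexSgn, mul_pow]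
  ring

/-- The squared distance between the vectors `‖v‖ u` and `-‖u‖ v` of equal length. -/
theorem norm_smul_add_norm_smul_sq (u v : E) :
    ‖(‖v‖ : ℂ) • u + (‖u‖ : ℂ) • v‖ ^ 2
      = 2 * ‖u‖ * ‖v‖ * (‖u‖ * ‖v‖ + (inner ℂ v u : ℂ).re) := by
  rw [norm_smul_add_smul_sq]
  ring

theorem norm_smul_sub_complexSgn_smul_norm_smul_sq (u v : E) :
    ‖(‖v‖ : ℂ) • u - complexSgn (inner ℂ v u) • (‖u‖ : ℂ) • v‖ ^ 2
      = 2 * ‖u‖ * ‖v‖ * (‖u‖ * ‖v‖ - ‖(inner ℂ v u : ℂ)‖) := by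
  rw [norm_smul_sub_complexSgn_smul_sq]
  ring

end ParallelVectors

/-! ### Gaussian states -/

section Gaussian

variable {n : ℕ} {φ : ScalarL2 n}

theorem positionMul_ae_eq (hB : φ ∈ positionDomain n) (j : Fin n) :
    ∀ᵐ x, positionMul φ hB j x = (x j : ℂ) * φ x :=
  MemLp.coeFn_toLp (hB j)

/-- The real part of `(xφ|∇φ)`, by summing the commutation relations over the coordinates. -/
theorem natCast_mul_norm_sq_eq (hA : φ ∈ momentumDomain n) (hB : φ ∈ positionDomain n) :
    (n : ℝ) * ‖φ‖ ^ 2 = -2 * (scalarProd (positionMul φ hB) (weakGradient φ hA)).re := by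
  rw [scalarProd, PiLp.inner_apply, Complex.re_sum, Finset.mul_sum]
  simp_rw [← fun j => (isWeakPartialDeriv_weakGradient φ hA j).norm_sq_eq
    (positionMul_ae_eq hB j)]
  simp

/-- For `Re w < 0`, the equation `∇φ = w xφ` characterises the Gaussians `exp (w |x|² / 2)`, up to a
constant factor whose modulus is determined by `‖φ‖`. -/
theorem weakGradient_eq_smul_positionMul_iff (hA : φ ∈ momentumDomain n)
    (hB : φ ∈ positionDomain n) {w : ℂ} (hw : w.re < 0) :
    weakGradient φ hA = w • positionMul φ hB ↔
      ∃ θ : ℝ, ∀ᵐ x : EuclideanSpace ℝ (Fin n), φ x =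
        Complex.exp (Complex.I * (θ : ℂ)) * (((-w.re / Real.pi) ^ ((n : ℝ) / 4) : ℝ) : ℂ) *
          (‖φ‖ : ℂ) * Complex.exp (w * ((‖x‖ : ℂ) ^ 2 / 2)) := by
  have hwX : ∀ j, ∀ᵐ x, (w • positionMul φ hB) j x = w * ((x j : ℂ) * φ x) := fun j => by
    filter_upwards [Lp.coeFn_smul w (positionMul φ hB j), positionMul_ae_eq hB j] with x h1 h2
    rw [PiLp.smul_apply, h1, Pi.smul_apply, h2, smul_eq_mul]
  constructor
  · intro h
    obtain ⟨c, hc⟩ := exists_ae_eq_mul_cexp w (isWeakPartialDeriv_weakGradient φ hA)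
      (by rw [h]; exact hwX)
    refine ⟨c.arg, hc.mono fun x hx => ?_⟩
    have hnorm := norm_sq_of_ae_eq_mul_cexp hw hc
    have hpos : 0 < -w.re / Real.pi := div_pos (by linarith) Real.pi_pos
    have hcn : ‖c‖ = (-w.re / Real.pi) ^ ((n : ℝ) / 4) * ‖φ‖ := by
      refine (pow_left_inj₀ (norm_nonneg c) (by positivity) two_ne_zero).mp ?_
      rw [mul_pow, hnorm, ← inv_div (-w.re), Real.inv_rpow hpos.le, ← Real.rpow_mul_natCast hpos.le,
        show (n : ℝ) / 4 * (2 : ℕ) = n / 2 by push_cast; ring, mul_left_comm,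
        mul_inv_cancel₀ (Real.rpow_pos_of_pos hpos _).ne', mul_one]
    have hcp : c = (((-w.re / Real.pi) ^ ((n : ℝ) / 4) * ‖φ‖ : ℝ) : ℂ) *
        Complex.exp (c.arg * Complex.I) := by
      rw [← hcn, Complex.norm_mul_exp_arg_mul_I]
    conv_lhs => rw [hx, hcp]
    push_cast
    ring_nf
  · rintro ⟨θ, h⟩
    ext1 j
    exact (isWeakPartialDeriv_weakGradient φ hA j).unique
      (isWeakPartialDeriv_of_ae_eq_mul_cexp h (hwX j))

end Gaussian

theorem theorem3p1 (n : ℕ) (φ : ScalarL2 n)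
    (hA : φ ∈ momentumDomain n) (hB : φ ∈ positionDomain n)
    -- abbreviations: `X` is `xφ`, `G` is `∇φ`, `z` is `(xφ|∇φ)`
    (X G : VectorL2 n) (hX : X = positionMul φ hB) (hG : G = weakGradient φ hA)
    (z : ℂ) (hz : z = scalarProd X G) :
    -- the identities
    ((n : ℝ) * ‖φ‖ ^ 2 = -2 * z.re ∧
      (n : ℝ) * ‖φ‖ ^ 2 = ‖X‖ ^ 2 + ‖G‖ ^ 2 - ‖X + G‖ ^ 2 ∧
      (X ≠ 0 → G ≠ 0 →
        (n : ℝ) * ‖φ‖ ^ 2 =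
            ‖X‖ * ‖G‖ * (2 - ‖((‖X‖ : ℂ)⁻¹) • X + ((‖G‖ : ℂ)⁻¹) • G‖ ^ 2) ∧
          ‖z‖ = ‖X‖ * ‖G‖ *
            (1 - 1 / 2 * ‖((‖X‖ : ℂ)⁻¹) • X - complexSgn z • ((‖G‖ : ℂ)⁻¹) • G‖ ^ 2))) ∧
    -- coherent states
    List.TFAE [
      (n : ℝ) * ‖φ‖ ^ 2 = ‖X‖ ^ 2 + ‖G‖ ^ 2,
      X = -G,
      ∃ θ : ℝ, ∀ᵐ x : EuclideanSpace ℝ (Fin n), φ x =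
        Complex.exp (Complex.I * (θ : ℂ)) * ((1 / Real.pi ^ ((n : ℝ) / 4) : ℝ) : ℂ) * (‖φ‖ : ℂ) *
          Complex.exp (-((‖x‖ : ℂ) ^ 2 / 2))] ∧
    -- squeezed states
    (X ≠ 0 → List.TFAE [
      (n : ℝ) * ‖φ‖ ^ 2 = 2 * ‖X‖ * ‖G‖,
      (‖G‖ : ℂ) • X = -((‖X‖ : ℂ) • G),
      ∃ θ : ℝ, ∀ᵐ x : EuclideanSpace ℝ (Fin n), φ x =
        Complex.exp (Complex.I * (θ : ℂ)) *
          (((‖G‖ / (Real.pi * ‖X‖)) ^ ((n : ℝ) / 4) : ℝ) : ℂ) * (‖φ‖ : ℂ) *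
          Complex.exp (-(((‖G‖ / ‖X‖ : ℝ) : ℂ) * ((‖x‖ : ℂ) ^ 2 / 2)))]) ∧
    -- generalized squeezed states
    (X ≠ 0 → List.TFAE [
      ‖z‖ = ‖X‖ * ‖G‖,
      (‖G‖ : ℂ) • X = complexSgn z • (‖X‖ : ℂ) • G,
      ∃ θ : ℝ, ∀ᵐ x : EuclideanSpace ℝ (Fin n), φ x =
        Complex.exp (Complex.I * (θ : ℂ)) *
          (((-(complexSgn z).re * (‖G‖ / (Real.pi * ‖X‖))) ^ ((n : ℝ) / 4) : ℝ) : ℂ) *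
          (‖φ‖ : ℂ) *
          Complex.exp (complexSgn (conj z) * ((‖G‖ / ‖X‖ : ℝ) : ℂ) * ((‖x‖ : ℂ) ^ 2 / 2))]) ∧
    (X ≠ 0 → G ≠ 0 →
      z.re = (conj z).re ∧ (conj z).re = -((n : ℝ) / 2) * ‖φ‖ ^ 2 ∧ z.re < 0 ∧
        (complexSgn z).re = (complexSgn (conj z)).re ∧ (complexSgn z).re < 0) := by

  have hre : (n : ℝ) * ‖φ‖ ^ 2 = -2 * z.re := by
    rw [hz, hX, hG]; exact natCast_mul_norm_sq_eq hA hB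
  have hzi : z = inner ℂ G X := hz
  have hgauss : ∀ w : ℂ, w.re < 0 → (G = w • X ↔
      ∃ θ : ℝ, ∀ᵐ x : EuclideanSpace ℝ (Fin n), φ x =
        Complex.exp (Complex.I * (θ : ℂ)) * (((-w.re / Real.pi) ^ ((n : ℝ) / 4) : ℝ) : ℂ) *
          (‖φ‖ : ℂ) * Complex.exp (w * ((‖x‖ : ℂ) ^ 2 / 2))) := fun w hw => by
    rw [hG, hX]; exact weakGradient_eq_smul_positionMul_iff hA hB hw
  have hadd : ‖X + G‖ ^ 2 = ‖X‖ ^ 2 + ‖G‖ ^ 2 + 2 * z.re := by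
    have := norm_smul_add_smul_sq X G 1 1
    simpa [← hzi] using this
  -- `xφ ≠ 0` forces `n ≥ 1` and `φ ≠ 0`, so `Re z` is negative and `∇φ` does not vanish either.
  have hzneg : X ≠ 0 → z.re < 0 := by
    intro hX0
    have hn : n ≠ 0 := by
      rintro rfl
      exact hX0 (Subsingleton.elim _ _)
    have hφ : φ ≠ 0 := by
      intro h0
      refine hX0 ?_
      ext1 j
      rw [hX]
      apply Lp.ext
      filter_upwards [positionMul_ae_eq hB j, Lp.coeFn_zero ℂ 2
        (volume : Measure (EuclideanSpace ℝ (Fin n)))] with x h1 h2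
      rw [h1, PiLp.zero_apply, h2, h0, h2]
      simp
    have : 0 < (n : ℝ) * ‖φ‖ ^ 2 := by positivity
    linarith
  have hG0 : X ≠ 0 → G ≠ 0 := by
    rintro hX0 rfl
    have := hzneg hX0
    simp [hzi] at this
  refine ⟨⟨hre, by linarith, fun hX0 hG0 => ⟨?_, ?_⟩⟩, ?_, fun hX0 => ?_, fun hX0 => ?_,
    fun hX0 hG0 => ⟨by simp, ?_, hzneg hX0, ?_, complexSgn_re_neg (hzneg hX0)⟩⟩
  · have hx := norm_ne_zero_iff.mpr hX0
    have hg := norm_ne_zero_iff.mpr hG0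
    rw [← Complex.ofReal_inv, ← Complex.ofReal_inv, norm_smul_add_smul_sq, ← hzi, hre]
    field_simp
    ring
  · have hx := norm_ne_zero_iff.mpr hX0
    have hg := norm_ne_zero_iff.mpr hG0
    rw [← Complex.ofReal_inv, ← Complex.ofReal_inv, hzi, norm_smul_sub_complexSgn_smul_sq]
    field_simp
    ring
  · tfae_have 1 ↔ 2 := by
      rw [eq_neg_iff_add_eq_zero, ← norm_eq_zero, ← sq_eq_zero_iff, hadd, hre]
      constructor <;> intro h <;> linarith
    tfae_have 2 ↔ 3 := by
      have h1 : X = -G ↔ G = (-1 : ℂ) • X := by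
        rw [neg_one_smul, eq_comm, neg_eq_iff_eq_neg]
      rw [h1, hgauss (-1) (by simp)]
      simp [Real.inv_rpow Real.pi_pos.le]
    tfae_finish
  · have hx : 0 < ‖X‖ := norm_pos_iff.mpr hX0
    have hg : 0 < ‖G‖ := norm_pos_iff.mpr (hG0 hX0)
    have hxg : 0 < 2 * ‖X‖ * ‖G‖ := by positivity
    have hxC : (‖X‖ : ℂ) ≠ 0 := by exact_mod_cast hx.ne'
    tfae_have 1 ↔ 2 := by
      rw [eq_neg_iff_add_eq_zero, ← norm_eq_zero, ← sq_eq_zero_iff, norm_smul_add_norm_smul_sq,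
        ← hzi, mul_eq_zero, or_iff_right hxg.ne', hre]
      constructor <;> intro h <;> linarith
    tfae_have 2 ↔ 3 := by
      have h1 : (‖G‖ : ℂ) • X = -((‖X‖ : ℂ) • G) ↔ G = (-((‖G‖ / ‖X‖ : ℝ) : ℂ)) • X := by
        rw [← neg_eq_iff_eq_neg, eq_comm, ← eq_inv_smul_iff₀ hxC, ← neg_smul, smul_smul]
        push_cast
        rw [show (‖X‖ : ℂ)⁻¹ * -(‖G‖ : ℂ) = -((‖G‖ : ℂ) / ‖X‖) by ring]
      have h2 : ‖G‖ / ‖X‖ / Real.pi = ‖G‖ / (Real.pi * ‖X‖) := by rw [div_div, mul_comm]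
      rw [h1, hgauss _ (by rw [Complex.neg_re, Complex.ofReal_re, neg_lt_zero]; positivity)]
      simp only [Complex.neg_re, Complex.ofReal_re, neg_neg, h2, neg_mul]
    tfae_finish
  · have hx : 0 < ‖X‖ := norm_pos_iff.mpr hX0
    have hg : 0 < ‖G‖ := norm_pos_iff.mpr (hG0 hX0)
    have hxg : 0 < 2 * ‖X‖ * ‖G‖ := by positivity
    have hxC : (‖X‖ : ℂ) ≠ 0 := by exact_mod_cast hx.ne'
    have hs := complexSgn_mul_complexSgn_conj z
    have hsz : complexSgn z ≠ 0 := left_ne_zero_of_mul_eq_one hs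
    tfae_have 1 ↔ 2 := by
      rw [← sub_eq_zero (b := complexSgn z • _), ← norm_eq_zero, ← sq_eq_zero_iff, hzi,
        norm_smul_sub_complexSgn_smul_norm_smul_sq, mul_eq_zero, or_iff_right hxg.ne',
        sub_eq_zero, eq_comm]
    tfae_have 2 ↔ 3 := by
      have h1 : (‖G‖ : ℂ) • X = complexSgn z • (‖X‖ : ℂ) • G ↔
          G = (complexSgn (conj z) * ((‖G‖ / ‖X‖ : ℝ) : ℂ)) • X := by
        rw [eq_comm, smul_smul, ← eq_inv_smul_iff₀ (mul_ne_zero hsz hxC), smul_smul,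
          ← inv_eq_of_mul_eq_one_right hs]
        push_cast
        rw [mul_inv, mul_assoc, div_eq_inv_mul]
      have hw : (complexSgn (conj z) * ((‖G‖ / ‖X‖ : ℝ) : ℂ)).re
          = (complexSgn z).re * (‖G‖ / ‖X‖) := by
        rw [Complex.re_mul_ofReal, complexSgn_conj, Complex.conj_re]
      have h2 : -((complexSgn z).re * (‖G‖ / ‖X‖)) / Real.pi
          = -(complexSgn z).re * (‖G‖ / (Real.pi * ‖X‖)) := by
        rw [mul_comm Real.pi, ← div_div]; ring
      rw [h1, hgauss _ (by
        rw [hw]; exact mul_neg_of_neg_of_pos (complexSgn_re_neg (hzneg hX0)) (by positivity))]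
      simp only [hw, h2]
    tfae_finish
  · rw [Complex.conj_re]; linarith
  · rw [complexSgn_conj, Complex.conj_re]
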